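/- For real $x$ let $$\mathrm{Ai}(x)=\frac1\pi\int_0^\infty \cos\left(\frac{t^3}{3}+xt\right)dt=\lim_{T\to\infty}\frac1\pi\int_0^T \cos\left(\frac{t^3}{3}+xt\right)dt$$ be the Airy function. This improper integral converges for every $x\in\mathbb{R}$, and for every $s\in\mathbb{C}$ with $\operatorname{Re} s>0$ the Mellin transform of $\mathrm{Ai}$ converges absolutely and is given by $$\int_0^\infty x^{s-1}\,\mathrm{Ai}(x)\,dx=\frac{1}{2\pi}\,3^{(4s-7)/6}\,\Gamma\left(\frac{s+1}{3}\right)\Gamma\left(\frac{s}{3}\right).$$ -/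

import Mathlib

open Filter Topology

/-- The truncated Airy integral `(1/π) ∫₀ᵀ cos (t³/3 + x t) dt`. -/
noncomputable def airyPartial (x T : ℝ) : ℝ :=
  (1 / Real.pi) * ∫ t in (0 : ℝ)..T, Real.cos (t ^ 3 / 3 + x * t)

/-- The Airy function `Ai x = (1/π) ∫₀^∞ cos (t³/3 + x t) dt`. The integral is not absolutely
convergent; it is the improper Riemann integral, i.e. the limit of the truncated integrals. -/
noncomputable def airyAi (x : ℝ) : ℝ :=
  limUnder atTop (airyPartial x)

/-! Let Φ be the primitive of the entire function exp(i(z³/3 + xz)) with Φ(0) = 0; the truncated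
Airy integral is Re Φ(T)/π. Increments of Φ along vertical segments above T tend to 0 inside the
sector 0 ≤ arg z ≤ π/6, so the limit can be taken along the ray of angle π/6, where z³ = ir³ and the
integrand has modulus exp(-r³/3 - rx/2).

For real 0 < s < 1, Fubini applies to the ray formula. The x-integral is a Laplace transform at
r·exp(-iπ/3), equal to Γ(s) r^(-s) exp(iπs/3); the r-integral then yields Γ((1-s)/3). Reflection and
Gauss triplication (`Real.Gamma_triplication`) bring the real part to the stated form.

Shifting to Im z = 1 gives Ai(x) = O(exp(-x)) (`exists_abs_airyAi_le`), so the Mellin transform is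
analytic on Re s > 0 and the identity theorem finishes. -/

/-! ### Laplace transform of a power on the right half plane -/

theorem integrableOn_rpow_mul_exp_neg_mul {s b : ℝ} (hs : -1 < s) (hb : 0 < b) :
    MeasureTheory.IntegrableOn (fun t : ℝ => t ^ s * Real.exp (-b * t)) (Set.Ioi 0) := by
  simpa only [Real.rpow_one] using integrableOn_rpow_mul_exp_neg_mul_rpow hs one_pos hb

theorem norm_ofReal_rpow_mul_cexp (s t : ℝ) (b : ℂ) (ht : 0 < t) :
    ‖((t ^ s : ℝ) : ℂ) * Complex.exp (-b * t)‖ = t ^ s * Real.exp (-b.re * t) := by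
  rw [norm_mul, Complex.norm_exp, Complex.norm_real, Real.norm_of_nonneg (by positivity)]
  simp

theorem integrableOn_rpow_mul_cexp_neg_mul {s : ℝ} {b : ℂ} (hs : -1 < s) (hb : 0 < b.re) :
    MeasureTheory.IntegrableOn
      (fun t : ℝ => ((t ^ s : ℝ) : ℂ) * Complex.exp (-b * t)) (Set.Ioi 0) := by
  refine (integrableOn_rpow_mul_exp_neg_mul hs hb).mono' ?_ ?_
  · exact (by fun_prop : Measurable _).aestronglyMeasurable
  · filter_upwards [MeasureTheory.ae_restrict_mem measurableSet_Ioi] with t ht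
    exact (norm_ofReal_rpow_mul_cexp s t b ht).le

theorem differentiableAt_integral_rpow_mul_cexp_neg_mul {s : ℝ} {b : ℂ} (hs : 0 < s)
    (hb : 0 < b.re) :
    DifferentiableAt ℂ (fun b : ℂ =>
      ∫ t in Set.Ioi (0 : ℝ), ((t ^ (s - 1) : ℝ) : ℂ) * Complex.exp (-b * t)) b := by
  have hU : {z : ℂ | b.re / 2 < z.re} ∈ 𝓝 b :=
    (isOpen_lt continuous_const Complex.continuous_re).mem_nhds (by simp; linarith)
  refine (hasDerivAt_integral_of_dominated_loc_of_deriv_le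
    (F' := fun b t => -(((t ^ s : ℝ) : ℂ) * Complex.exp (-b * t)))
    (bound := fun t => t ^ s * Real.exp (-(b.re / 2) * t)) hU ?_ ?_ ?_ ?_ ?_ ?_).2.differentiableAt
  · exact .of_forall fun z => (by fun_prop : Measurable _).aestronglyMeasurable
  · exact integrableOn_rpow_mul_cexp_neg_mul (by linarith) hb
  · exact (by fun_prop : Measurable _).aestronglyMeasurable
  · filter_upwards [MeasureTheory.ae_restrict_mem measurableSet_Ioi] with t ht z hz
    have ht' : 0 < t := ht
    have hz' : b.re / 2 < z.re := hz
    rw [norm_neg, norm_ofReal_rpow_mul_cexp s t z ht]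
    gcongr
  · exact integrableOn_rpow_mul_exp_neg_mul (by linarith) (by linarith)
  · filter_upwards [MeasureTheory.ae_restrict_mem measurableSet_Ioi] with t ht z hz
    have ht' : t ≠ 0 := (Set.mem_Ioi.1 ht).ne'
    have h : HasDerivAt (fun z : ℂ => -z * (t : ℂ)) (-1 * (t : ℂ)) z :=
      (hasDerivAt_id z).neg.mul_const _
    convert! h.cexp.const_mul ((t ^ (s - 1) : ℝ) : ℂ) using 1
    rw [Real.rpow_sub_one ht']
    push_cast
    have : (t : ℂ) ≠ 0 := by exact_mod_cast ht'
    field_simp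

/-- The Laplace transform of `t ^ (s - 1)` on the right half plane. -/
theorem integral_rpow_mul_cexp_neg_mul_Ioi {s : ℝ} {b : ℂ} (hs : 0 < s) (hb : 0 < b.re) :
    ∫ t in Set.Ioi (0 : ℝ), ((t ^ (s - 1) : ℝ) : ℂ) * Complex.exp (-b * t) =
      b ^ (-(s : ℂ)) * Real.Gamma s := by
  have hopen : IsOpen {z : ℂ | 0 < z.re} := isOpen_lt continuous_const Complex.continuous_re
  have hf : AnalyticOnNhd ℂ (fun b : ℂ =>
      ∫ t in Set.Ioi (0 : ℝ), ((t ^ (s - 1) : ℝ) : ℂ) * Complex.exp (-b * t)) {z | 0 < z.re} :=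
    DifferentiableOn.analyticOnNhd (fun z hz =>
      (differentiableAt_integral_rpow_mul_cexp_neg_mul hs hz).differentiableWithinAt) hopen
  have hg : AnalyticOnNhd ℂ (fun b : ℂ => b ^ (-(s : ℂ)) * Real.Gamma s) {z | 0 < z.re} :=
    DifferentiableOn.analyticOnNhd (fun z hz =>
      ((differentiableAt_id.cpow_const (.inl hz)).mul_const _).differentiableWithinAt) hopen
  refine hf.eqOn_of_preconnected_of_frequently_eq hg
    (convex_halfSpace_re_gt 0).isPreconnected (z₀ := 1) (by simp) ?_ hb
  -- The formula is known for real b, and the reals r > 1 accumulate at z₀ = 1.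
  have htend : Tendsto (fun r : ℝ => (r : ℂ)) (𝓝[>] 1) (𝓝[≠] 1) := by
    refine tendsto_nhdsWithin_iff.2 ⟨?_, ?_⟩
    · exact (Complex.continuous_ofReal.tendsto' 1 1 (by simp)).mono_left nhdsWithin_le_nhds
    · filter_upwards [self_mem_nhdsWithin] with r hr
      simpa using (Set.mem_Ioi.1 hr).ne'
  refine htend.frequently (Eventually.frequently ?_)
  filter_upwards [self_mem_nhdsWithin] with r hr
  have hr0 : 0 < r := one_pos.trans hr
  have h := Real.integral_rpow_mul_exp_neg_mul_Ioi hs hr0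
  rw [← Complex.ofReal_neg, ← Complex.ofReal_neg, ← Complex.ofReal_cpow hr0.le, ← Complex.ofReal_mul,
    Real.rpow_neg hr0.le, ← Real.inv_rpow hr0.le, ← one_div, ← h, ← integral_complex_ofReal]
  congr 1 with t
  push_cast
  ring_nf

/-! ### Gauss triplication -/

theorem Real.convexOn_log_Gamma_div_add (n : ℝ) (hn : 0 < n) (a : ℝ) (ha : 0 ≤ a) :
    ConvexOn ℝ (Set.Ioi 0) (fun s => Real.log (Real.Gamma ((s + a) / n))) := by
  refine ⟨convex_Ioi _, fun x hx y hy p q hp hq hpq => ?_⟩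
  have hx' : 0 < x := hx
  have hy' : 0 < y := hy
  have h := Real.convexOn_log_Gamma.2 (x := (x + a) / n) (y := (y + a) / n)
    (by simp only [Set.mem_Ioi]; positivity) (by simp only [Set.mem_Ioi]; positivity) hp hq hpq
  have e : (p • x + q • y + a) / n = p • ((x + a) / n) + q • ((y + a) / n) := by
    simp only [smul_eq_mul]
    field_simp
    linear_combination -a * hpq
  simpa only [e, Function.comp_apply] using h

/-- Gauss's multiplication formula for three factors, for positive real arguments. -/
theorem Real.Gamma_triplication {s : ℝ} (hs : 0 < s) :
    3 ^ s * Real.Gamma (s / 3) * Real.Gamma ((s + 1) / 3) * Real.Gamma ((s + 2) / 3) =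
      2 * √3 * Real.pi * Real.Gamma s := by
  have hC : (0 : ℝ) < 2 * √3 * Real.pi := by positivity
  have hG : ∀ {y : ℝ}, 0 < y → 0 < Real.Gamma (y / 3) ∧ 0 < Real.Gamma ((y + 1) / 3) ∧
      0 < Real.Gamma ((y + 2) / 3) := fun hy =>
    ⟨Real.Gamma_pos_of_pos (by positivity), Real.Gamma_pos_of_pos (by positivity),
      Real.Gamma_pos_of_pos (by positivity)⟩
  -- Bohr–Mollerup: the normalised product is log-convex, satisfies f(y + 1) = y f(y), is positive,
  -- and has f(1) = 1 because Γ(1/3)Γ(2/3) = 2π/√3.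
  have key := Real.eq_Gamma_of_log_convex (f := fun s => 3 ^ s * Real.Gamma (s / 3) *
    Real.Gamma ((s + 1) / 3) * Real.Gamma ((s + 2) / 3) / (2 * √3 * Real.pi)) ?_ ?_ ?_ ?_ hs
  · rw [← key]
    field_simp
  · have h0 := Real.convexOn_log_Gamma_div_add 3 (by norm_num) 0 le_rfl
    have h1 := Real.convexOn_log_Gamma_div_add 3 (by norm_num) 1 zero_le_one
    have h2 := Real.convexOn_log_Gamma_div_add 3 (by norm_num) 2 zero_le_two
    have h3 := (convexOn_id (convex_Ioi (0 : ℝ))).smul (Real.log_nonneg (by norm_num : (1:ℝ) ≤ 3))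
    refine ((((h3.add h0).add h1).add h2).add_const (-Real.log (2 * √3 * Real.pi))).congr ?_
    intro y hy
    obtain ⟨g0, g1, g2⟩ := hG (Set.mem_Ioi.1 hy)
    have h3y : (0 : ℝ) < 3 ^ y := by positivity
    simp only [Function.comp_apply]
    rw [Real.log_div (by positivity) hC.ne', Real.log_mul (by positivity) g2.ne',
      Real.log_mul (by positivity) g1.ne', Real.log_mul (by positivity) g0.ne',
      Real.log_rpow (by norm_num)]
    simp
    ring
  · intro y hy
    have e1 : (y + 1 + 1) / 3 = (y + 2) / 3 := by ring
    have e2 : (y + 1 + 2) / 3 = y / 3 + 1 := by ring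
    simp only [e1, e2]
    rw [Real.Gamma_add_one (by positivity), Real.rpow_add_one (by norm_num)]
    ring
  · intro y hy
    obtain ⟨g0, g1, g2⟩ := hG hy
    positivity
  · have h := Real.Gamma_mul_Gamma_one_sub (1 / 3)
    have e : Real.sin (Real.pi * (1 / 3)) = √3 / 2 := by
      rw [← Real.sin_pi_div_three]; ring_nf
    rw [e] at h
    norm_num at h ⊢
    rw [mul_assoc 3, h, div_eq_one_iff_eq hC.ne']
    have := Real.sq_sqrt (show (0 : ℝ) ≤ 3 by norm_num)
    have h3 : √3 ≠ 0 := by positivity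
    field_simp
    nlinarith

/-! ### Primitive of the Airy integrand and vertical segments -/

/-- The entire integrand `exp (i (z³/3 + x z))` whose real part on the real axis is the Airy
integrand. -/
noncomputable def airyIntegrand (x : ℝ) (z : ℂ) : ℂ :=
  Complex.exp (Complex.I * (z ^ 3 / 3 + x * z))

theorem continuous_airyIntegrand (x : ℝ) : Continuous (airyIntegrand x) := by
  unfold airyIntegrand
  fun_prop

/-- With a global primitive, contour deformation reduces to comparing values of Φ at endpoints. -/
theorem exists_hasDerivAt_airyIntegrand (x : ℝ) :
    ∃ Φ : ℂ → ℂ, Φ 0 = 0 ∧ ∀ z, HasDerivAt Φ (airyIntegrand x z) z := by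
  have h : Differentiable ℂ (airyIntegrand x) := by unfold airyIntegrand; fun_prop
  obtain ⟨Φ, h0, hΦ⟩ := h.isExactOn_univ.with_val_at 0 0
  exact ⟨Φ, h0, fun z => hΦ z trivial⟩

theorem norm_airyIntegrand (x t y : ℝ) :
    ‖airyIntegrand x (t + y * Complex.I)‖ = Real.exp (-(t ^ 2 * y - y ^ 3 / 3 + x * y)) := by
  rw [airyIntegrand, Complex.norm_exp]
  congr 1
  have : Complex.I * (((t : ℂ) + y * Complex.I) ^ 3 / 3 + x * (t + y * Complex.I)) =
      ((-(t ^ 2 * y - y ^ 3 / 3 + x * y) : ℝ) : ℂ) +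
        ((t ^ 3 / 3 - t * y ^ 2 + x * t : ℝ) : ℂ) * Complex.I := by
    push_cast
    linear_combination (x * (y : ℂ) + t ^ 2 * y + y ^ 2 * t * Complex.I +
      y ^ 3 / 3 * (Complex.I ^ 2 - 1)) * Complex.I_sq
  rw [this, Complex.add_re, Complex.re_ofReal_mul, Complex.I_re, mul_zero, add_zero,
    Complex.ofReal_re]

theorem integral_along_line {f Φ : ℂ → ℂ} (hf : Continuous f) (hΦ : ∀ z, HasDerivAt Φ (f z) z)
    (a c : ℂ) (p q : ℝ) :
    ∫ t in p..q, c * f (a + t * c) = Φ (a + q * c) - Φ (a + p * c) := by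
  refine intervalIntegral.integral_eq_sub_of_hasDerivAt (f := fun t : ℝ => Φ (a + t * c))
    (fun t _ => ?_) (Continuous.intervalIntegrable (by fun_prop) _ _)
  have h : HasDerivAt (fun t : ℝ => a + (t : ℂ) * c) (1 * c) t :=
    ((Complex.ofRealCLM.hasDerivAt (x := t)).mul_const c).const_add a
  have := (hΦ (a + t * c)).comp t h
  rw [one_mul, mul_comm] at this
  exact this

/-- For y ≤ Y one has y²/3 ≤ T²/9, so the decay exponent T²y - y³/3 + xy is at least (8T²/9 - |x|)y.
The bound does not depend on Y, which may therefore grow with T up to the ray. -/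
theorem norm_primitive_vertical_sub_le {x : ℝ} {Φ : ℂ → ℂ}
    (hΦ : ∀ z, HasDerivAt Φ (airyIntegrand x z) z) {T Y : ℝ} (hY : 0 ≤ Y)
    (hYT : 3 * Y ^ 2 ≤ T ^ 2) (hT : 0 < 8 / 9 * T ^ 2 - |x|) :
    ‖Φ (T + Y * Complex.I) - Φ T‖ ≤ (8 / 9 * T ^ 2 - |x|)⁻¹ := by
  set k := 8 / 9 * T ^ 2 - |x| with hk
  have h := integral_along_line (continuous_airyIntegrand x) hΦ T Complex.I 0 Y
  simp only [Complex.ofReal_zero, zero_mul, add_zero] at h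
  rw [← h]
  have hint : ∫ y in (0 : ℝ)..Y, Real.exp (-k * y) = (1 - Real.exp (-k * Y)) / k := by
    rw [intervalIntegral.integral_comp_mul_left (fun y => Real.exp y) (neg_ne_zero.2 hT.ne')]
    simp
    field_simp
    ring
  calc _ ≤ ∫ y in (0 : ℝ)..Y, Real.exp (-k * y) := by
        refine intervalIntegral.norm_integral_le_of_norm_le hY (.of_forall fun y hy => ?_)
          (Continuous.intervalIntegrable (by fun_prop) _ _)
        rw [norm_mul, Complex.norm_I, one_mul, norm_airyIntegrand]
        refine Real.exp_le_exp.2 ?_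
        have h1 : 3 * y ^ 2 ≤ T ^ 2 := by
          have := hy.1; have := hy.2; nlinarith
        have h2 := neg_abs_le x
        have h3 := hy.1
        rw [hk]
        nlinarith [mul_nonneg h3.le (sub_nonneg.2 h1), mul_nonneg h3.le (neg_le_iff_add_nonneg.1 h2)]
    _ ≤ k⁻¹ := by
        rw [hint, div_eq_mul_inv]
        have := Real.exp_pos (-k * Y)
        have := inv_pos.2 hT
        nlinarith

theorem tendsto_primitive_vertical_sub {x : ℝ} {Φ : ℂ → ℂ}
    (hΦ : ∀ z, HasDerivAt Φ (airyIntegrand x z) z) {Y : ℝ → ℝ}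
    (hY : ∀ᶠ T in atTop, 0 ≤ Y T ∧ 3 * Y T ^ 2 ≤ T ^ 2) :
    Tendsto (fun T : ℝ => Φ (T + Y T * Complex.I) - Φ T) atTop (𝓝 0) := by
  have hk : Tendsto (fun T : ℝ => 8 / 9 * T ^ 2 - |x|) atTop atTop :=
    tendsto_atTop_add_const_right _ _
      ((tendsto_pow_atTop two_ne_zero).const_mul_atTop (by norm_num))
  refine squeeze_zero_norm' ?_ (tendsto_inv_atTop_zero.comp hk)
  filter_upwards [hY, hk.eventually_gt_atTop 0] with T hT hT'
  exact norm_primitive_vertical_sub_le hΦ hT.1 hT.2 hT'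

/-! ### Convergence and the ray formula -/

/-- The direction `exp (iπ/6)` of steepest descent. -/
noncomputable def airyRay : ℂ := (√3 / 2 : ℝ) + (1 / 2 : ℝ) * Complex.I

theorem airyRay_pow_three : airyRay ^ 3 = Complex.I := by
  have h : ((√3 : ℝ) : ℂ) ^ 2 = 3 := by
    exact_mod_cast Real.sq_sqrt (show (0 : ℝ) ≤ 3 by norm_num)
  rw [airyRay]
  push_cast
  linear_combination (√3 / 8 + 3 / 8 * Complex.I) * h +
    (3 / 8 * (√3 : ℂ) + Complex.I / 8) * Complex.I_sq

theorem airyIntegrand_ray (x r : ℝ) :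
    airyIntegrand x (r * airyRay) =
      Complex.exp (-(r : ℂ) ^ 3 / 3) * Complex.exp (-(-Complex.I * airyRay * r) * x) := by
  rw [airyIntegrand, ← Complex.exp_add]
  congr 1
  linear_combination Complex.I * r ^ 3 / 3 * airyRay_pow_three + (r : ℂ) ^ 3 / 3 * Complex.I_sq

theorem re_neg_I_mul_airyRay : (-Complex.I * airyRay).re = 1 / 2 := by
  simp [airyRay]

theorem norm_airyIntegrand_ray (x r : ℝ) :
    ‖airyIntegrand x (r * airyRay)‖ = Real.exp (-r ^ 3 / 3) * Real.exp (-(r / 2) * x) := by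
  rw [airyIntegrand_ray, norm_mul, Complex.norm_exp, Complex.norm_exp]
  congr 2
  · rw [← Complex.ofReal_re (-r ^ 3 / 3)]
    push_cast
    rfl
  · rw [Complex.re_mul_ofReal, Complex.neg_re, Complex.re_mul_ofReal, re_neg_I_mul_airyRay]
    ring

theorem integrableOn_airyIntegrand_ray (x : ℝ) :
    MeasureTheory.IntegrableOn (fun r : ℝ => airyIntegrand x (r * airyRay)) (Set.Ioi 0) := by
  have hc : Continuous fun r : ℝ => airyIntegrand x (r * airyRay) :=
    (continuous_airyIntegrand x).comp (by fun_prop)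
  refine (MeasureTheory.integrable_norm_iff hc.aestronglyMeasurable).1
    (integrable_of_isBigO_exp_neg (a := 0) (b := 1) one_pos hc.norm.continuousOn (.of_bound 1 ?_))
  -- These thresholds give r³/3 ≥ r²(|x| + 1) ≥ r(|x| + 1) ≥ r - rx/2.
  filter_upwards [eventually_ge_atTop (3 * (|x| + 1)), eventually_ge_atTop 1] with r hr hr1
  rw [norm_norm, norm_airyIntegrand_ray, one_mul, Real.norm_of_nonneg (Real.exp_pos _).le,
    ← Real.exp_add]
  refine Real.exp_le_exp.2 ?_
  have h2 := neg_abs_le x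
  have h3 := abs_nonneg x
  nlinarith [mul_nonneg (by linarith : (0 : ℝ) ≤ r) (neg_le_iff_add_nonneg.1 h2),
    mul_nonneg (by linarith : (0 : ℝ) ≤ r) (sub_nonneg.2 hr1),
    mul_nonneg (by nlinarith : (0 : ℝ) ≤ r * r) (sub_nonneg.2 hr), mul_nonneg h3 (by linarith : (0:ℝ) ≤ r),
    mul_nonneg (mul_nonneg (by linarith : (0 : ℝ) ≤ r) (sub_nonneg.2 hr1)) (by linarith : 0 ≤ |x| + 1)]

theorem tendsto_primitive_airyIntegrand {x : ℝ} {Φ : ℂ → ℂ} (h0 : Φ 0 = 0)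
    (hΦ : ∀ z, HasDerivAt Φ (airyIntegrand x z) z) :
    Tendsto (fun T : ℝ => Φ T) atTop
      (𝓝 (airyRay * ∫ r in Set.Ioi (0 : ℝ), airyIntegrand x (r * airyRay))) := by
  have h3 : (0 : ℝ) < √3 := by positivity
  have hs : √3 ^ 2 = 3 := Real.sq_sqrt (by norm_num)
  -- The ray meets the vertical line Re z = T at distance 2T/√3 from 0 and height T/√3.
  have hR : Tendsto (fun T : ℝ => 2 / √3 * T) atTop atTop :=
    tendsto_id.const_mul_atTop (by positivity)
  have h := (MeasureTheory.intervalIntegral_tendsto_integral_Ioi 0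
    (integrableOn_airyIntegrand_ray x) hR).const_mul airyRay
  have hv := tendsto_primitive_vertical_sub hΦ (Y := fun T => T / √3) (by
    filter_upwards [eventually_ge_atTop 0] with T hT
    refine ⟨by positivity, ?_⟩
    rw [div_pow, hs]
    linarith)
  have := h.sub hv
  rw [sub_zero] at this
  refine this.congr fun T => ?_
  have hl := integral_along_line (continuous_airyIntegrand x) hΦ 0 airyRay 0 (2 / √3 * T)
  simp only [zero_add, Complex.ofReal_zero, zero_mul, h0, sub_zero,
    intervalIntegral.integral_const_mul] at hl
  have e : ((2 / √3 * T : ℝ) : ℂ) * airyRay = T + (T / √3 : ℝ) * Complex.I := by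
    have : (√3 : ℂ) ≠ 0 := by exact_mod_cast h3.ne'
    rw [airyRay]
    push_cast
    field_simp
  rw [hl, e]
  ring

theorem airyPartial_eq_re_primitive {x : ℝ} {Φ : ℂ → ℂ} (h0 : Φ 0 = 0)
    (hΦ : ∀ z, HasDerivAt Φ (airyIntegrand x z) z) (T : ℝ) :
    airyPartial x T = 1 / Real.pi * (Φ T).re := by
  have hl := integral_along_line (continuous_airyIntegrand x) hΦ 0 1 0 T
  simp only [zero_add, Complex.ofReal_zero, h0, sub_zero, one_mul, mul_one] at hl
  rw [airyPartial, ← hl, ← Complex.reCLM_apply, ← ContinuousLinearMap.intervalIntegral_comp_comm]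
  · congr 2 with t
    rw [Complex.reCLM_apply, airyIntegrand, ← Complex.exp_ofReal_mul_I_re]
    push_cast
    ring_nf
  · exact ((continuous_airyIntegrand x).comp Complex.continuous_ofReal).intervalIntegrable _ _

theorem tendsto_airyPartial (x : ℝ) :
    Tendsto (airyPartial x) atTop (𝓝 (1 / Real.pi *
      (airyRay * ∫ r in Set.Ioi (0 : ℝ), airyIntegrand x (r * airyRay)).re)) := by
  obtain ⟨Φ, h0, hΦ⟩ := exists_hasDerivAt_airyIntegrand x
  rw [funext (airyPartial_eq_re_primitive h0 hΦ)]
  exact ((Complex.continuous_re.tendsto _).comp (tendsto_primitive_airyIntegrand h0 hΦ)).const_mul _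

/-- The Airy function as an absolutely convergent integral along the ray of direction
`exp (iπ/6)`. -/
theorem airyAi_eq_integral_ray (x : ℝ) :
    airyAi x = 1 / Real.pi *
      (airyRay * ∫ r in Set.Ioi (0 : ℝ), airyIntegrand x (r * airyRay)).re :=
  (tendsto_airyPartial x).limUnder_eq

/-! ### Exponential decay -/

/-- The integrand is real on the imaginary axis, so Φ(i) is purely imaginary and only the line Im z
= 1 contributes; there the modulus is exp(1/3 - x - t²). Absolute values on the ray would give only
O(1/x). -/
theorem abs_re_primitive_le {x : ℝ} {Φ : ℂ → ℂ} (h0 : Φ 0 = 0)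
    (hΦ : ∀ z, HasDerivAt Φ (airyIntegrand x z) z) {T : ℝ} (hT : 0 ≤ T) :
    |(Φ (T + Complex.I)).re| ≤
      Real.exp (1 / 3 - x) * ∫ t in Set.Ioi (0 : ℝ), Real.exp (-1 * t ^ 2) := by
  have hi : (Φ Complex.I).re = 0 := by
    have hl := integral_along_line (continuous_airyIntegrand x) hΦ 0 Complex.I 0 1
    simp only [zero_add, Complex.ofReal_zero, Complex.ofReal_one, zero_mul, one_mul, h0,
      sub_zero] at hl
    have : ∀ t : ℝ, airyIntegrand x (t * Complex.I) = ((Real.exp (t ^ 3 / 3 - x * t) : ℝ) : ℂ) := by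
      intro t
      rw [airyIntegrand]
      push_cast
      congr 1
      linear_combination (t ^ 3 / 3 * (Complex.I ^ 2 - 1) + x * (t : ℂ)) * Complex.I_sq
    simp only [this, intervalIntegral.integral_const_mul, intervalIntegral.integral_ofReal] at hl
    rw [← hl]
    simp
  have hl := integral_along_line (continuous_airyIntegrand x) hΦ Complex.I 1 0 T
  simp only [Complex.ofReal_zero, one_mul, mul_one, add_zero] at hl
  have e : (Φ (T + Complex.I)).re =
      (∫ t in (0 : ℝ)..T, airyIntegrand x (Complex.I + t)).re := by
    rw [hl, Complex.sub_re, hi, sub_zero, add_comm]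
  have hint : MeasureTheory.Integrable fun t : ℝ => Real.exp (-1 * t ^ 2) :=
    integrable_exp_neg_mul_sq one_pos
  rw [e]
  calc _ ≤ ‖∫ t in (0 : ℝ)..T, airyIntegrand x (Complex.I + t)‖ := Complex.abs_re_le_norm _
    _ ≤ ∫ t in (0 : ℝ)..T, Real.exp (1 / 3 - x) * Real.exp (-1 * t ^ 2) := by
        refine intervalIntegral.norm_integral_le_of_norm_le hT (.of_forall fun t _ => ?_)
          (hint.const_mul _).intervalIntegrable
        have := norm_airyIntegrand x t 1
        rw [Complex.ofReal_one, one_mul] at this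
        rw [add_comm, this, ← Real.exp_add]
        exact Real.exp_le_exp.2 (by linarith)
    _ ≤ _ := by
        rw [intervalIntegral.integral_const_mul, intervalIntegral.integral_of_le hT]
        refine mul_le_mul_of_nonneg_left ?_ (Real.exp_pos _).le
        exact MeasureTheory.setIntegral_mono_set hint.integrableOn
          (.of_forall fun t => (Real.exp_pos _).le) (Set.Ioc_subset_Ioi_self).eventuallyLE

theorem exists_abs_airyAi_le : ∃ K : ℝ, ∀ x, |airyAi x| ≤ K * Real.exp (-x) := by
  refine ⟨1 / Real.pi * (Real.exp (1 / 3) * ∫ t in Set.Ioi (0 : ℝ), Real.exp (-1 * t ^ 2)),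
    fun x => ?_⟩
  obtain ⟨Φ, h0, hΦ⟩ := exists_hasDerivAt_airyIntegrand x
  have hv := tendsto_primitive_vertical_sub hΦ (Y := fun _ => 1) (by
    filter_upwards [eventually_ge_atTop 2] with T hT
    constructor <;> nlinarith)
  have h := hv.add (tendsto_primitive_airyIntegrand h0 hΦ)
  simp only [sub_add_cancel, zero_add, Complex.ofReal_one, one_mul] at h
  have hle := le_of_tendsto ((Complex.continuous_re.tendsto _).comp h).abs
    ((eventually_ge_atTop 0).mono fun T hT => abs_re_primitive_le h0 hΦ hT)
  rw [airyAi_eq_integral_ray, abs_mul, abs_of_pos (by positivity : 0 < 1 / Real.pi)]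
  rw [sub_eq_add_neg, Real.exp_add] at hle
  calc _ ≤ _ := mul_le_mul_of_nonneg_left hle (by positivity)
    _ = _ := by ring

/-! ### Mellin transform for real 0 < s < 1 -/

theorem airyRay_eq_exp : airyRay = Complex.exp ((Real.pi / 6 : ℝ) * Complex.I) := by
  rw [Complex.exp_mul_I, ← Complex.ofReal_cos, ← Complex.ofReal_sin, Real.cos_pi_div_six,
    Real.sin_pi_div_six, airyRay]

theorem neg_I_mul_airyRay_eq_exp :
    -Complex.I * airyRay = Complex.exp ((-(Real.pi / 3) : ℝ) * Complex.I) := by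
  rw [Complex.exp_mul_I, ← Complex.ofReal_cos, ← Complex.ofReal_sin, Real.cos_neg, Real.sin_neg,
    Real.cos_pi_div_three, Real.sin_pi_div_three, airyRay]
  push_cast
  linear_combination -(1 / 2 : ℂ) * Complex.I_sq

theorem neg_I_mul_airyRay_mul_cpow {r : ℝ} (hr : 0 < r) (s : ℝ) :
    (-Complex.I * airyRay * r) ^ (-(s : ℂ)) =
      ((r ^ (-s) : ℝ) : ℂ) * Complex.exp ((Real.pi * s / 3 : ℝ) * Complex.I) := by
  have e : -Complex.I * airyRay * r =
      Complex.exp (Real.log r + (-(Real.pi / 3) : ℝ) * Complex.I) := by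
    rw [Complex.exp_add, ← Complex.ofReal_exp, Real.exp_log hr, neg_I_mul_airyRay_eq_exp, mul_comm]
  have hpi := Real.pi_pos
  have him : ((Real.log r : ℂ) + (-(Real.pi / 3) : ℝ) * Complex.I).im = -(Real.pi / 3) := by
    rw [Complex.add_im, Complex.ofReal_im, zero_add, Complex.im_ofReal_mul, Complex.I_im, mul_one]
  -- The argument -π/3 lies in (-π, π], so the principal logarithm recovers the exponent.
  rw [Complex.cpow_def_of_ne_zero (by rw [e]; exact Complex.exp_ne_zero _), e,
    Complex.log_exp (by rw [him]; linarith) (by rw [him]; linarith), Real.rpow_def_of_pos hr,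
    Complex.ofReal_exp, ← Complex.exp_add]
  congr 1
  push_cast
  ring

theorem re_neg_I_mul_airyRay_mul (r : ℝ) : (-Complex.I * airyRay * r).re = r / 2 := by
  rw [Complex.re_mul_ofReal, re_neg_I_mul_airyRay]
  ring

theorem integrableOn_rpow_neg_mul_exp_neg_cube {s : ℝ} (hs : s < 1) :
    MeasureTheory.IntegrableOn (fun r : ℝ => r ^ (-s) * Real.exp (-r ^ 3 / 3)) (Set.Ioi 0) := by
  have h := integrableOn_rpow_mul_exp_neg_mul_rpow (s := -s) (p := 3) (b := 1 / 3)
    (by linarith) (by norm_num) (by norm_num)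
  refine h.congr_fun (fun r _ => ?_) measurableSet_Ioi
  have : r ^ (3 : ℝ) = r ^ 3 := by exact_mod_cast Real.rpow_natCast r 3
  simp only [this]
  ring_nf

theorem integral_rpow_neg_mul_exp_neg_cube {s : ℝ} (hs : s < 1) :
    ∫ r in Set.Ioi (0 : ℝ), r ^ (-s) * Real.exp (-r ^ 3 / 3) =
      3 ^ ((1 - s) / 3 - 1) * Real.Gamma ((1 - s) / 3) := by
  have h := integral_rpow_mul_exp_neg_mul_rpow (q := -s) (p := 3) (b := 1 / 3)
    (by norm_num) (by linarith) (by norm_num)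
  have e : ∀ r : ℝ, Real.exp (-r ^ 3 / 3) = Real.exp (-(1 / 3) * r ^ (3 : ℝ)) := by
    intro r
    have : r ^ (3 : ℝ) = r ^ 3 := by exact_mod_cast Real.rpow_natCast r 3
    rw [this]
    ring_nf
  simp only [e, h]
  rw [one_div, Real.inv_rpow (by norm_num), ← Real.rpow_neg (by norm_num),
    Real.rpow_sub_one (by norm_num)]
  ring_nf

/-- Integrating the norm over x leaves 2^s Γ(s) r^(-s) exp(-r³/3), integrable at r = 0 because s <
1. -/
theorem integrable_rpow_mul_airyIntegrand_ray {s : ℝ} (hs : 0 < s) (hs1 : s < 1) :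
    MeasureTheory.Integrable
      (Function.uncurry fun x r : ℝ => ((x ^ (s - 1) : ℝ) : ℂ) * airyIntegrand x (r * airyRay))
      ((MeasureTheory.volume.restrict (Set.Ioi 0)).prod
        (MeasureTheory.volume.restrict (Set.Ioi 0))) := by
  have hm : Measurable
      (Function.uncurry fun x r : ℝ => ((x ^ (s - 1) : ℝ) : ℂ) * airyIntegrand x (r * airyRay)) := by
    unfold airyIntegrand Function.uncurry
    fun_prop
  refine (MeasureTheory.integrable_prod_iff' hm.aestronglyMeasurable).2 ⟨?_, ?_⟩
  · filter_upwards [MeasureTheory.ae_restrict_mem measurableSet_Ioi] with r hr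
    have h := integrableOn_rpow_mul_cexp_neg_mul (s := s - 1) (b := -Complex.I * airyRay * r)
      (by linarith) (by rw [re_neg_I_mul_airyRay_mul]; exact half_pos hr)
    refine (h.const_mul (Complex.exp (-(r : ℂ) ^ 3 / 3))).congr (.of_forall fun x => ?_)
    simp only [Function.uncurry, airyIntegrand_ray]
    ring
  · refine ((integrableOn_rpow_neg_mul_exp_neg_cube hs1).const_mul
      (2 ^ s * Real.Gamma s)).congr ?_
    filter_upwards [MeasureTheory.ae_restrict_mem measurableSet_Ioi] with r hr
    have hr0 : 0 < r := hr
    have h := Real.integral_rpow_mul_exp_neg_mul_Ioi hs (half_pos hr0)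
    have e : ∫ x in Set.Ioi (0 : ℝ), ‖((x ^ (s - 1) : ℝ) : ℂ) * airyIntegrand x (r * airyRay)‖ =
        ∫ x in Set.Ioi (0 : ℝ),
          Real.exp (-r ^ 3 / 3) * (x ^ (s - 1) * Real.exp (-(r / 2 * x))) := by
      refine MeasureTheory.setIntegral_congr_fun measurableSet_Ioi fun x hx => ?_
      have hx0 : 0 < x := hx
      simp only [norm_mul, norm_airyIntegrand_ray, Complex.norm_real]
      rw [Real.norm_of_nonneg (by positivity), neg_mul]
      ring
    simp only [Function.uncurry]
    rw [e, MeasureTheory.integral_const_mul, h, one_div_div, Real.div_rpow zero_le_two hr0.le,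
      Real.rpow_neg hr0.le]
    ring

theorem integral_integral_airyIntegrand_ray {s : ℝ} (hs : 0 < s) (hs1 : s < 1) :
    ∫ x in Set.Ioi (0 : ℝ), ∫ r in Set.Ioi (0 : ℝ),
      ((x ^ (s - 1) : ℝ) : ℂ) * airyIntegrand x (r * airyRay) =
    Complex.exp ((Real.pi * s / 3 : ℝ) * Complex.I) *
      ((Real.Gamma s * (3 ^ ((1 - s) / 3 - 1) * Real.Gamma ((1 - s) / 3)) : ℝ) : ℂ) := by
  rw [MeasureTheory.integral_integral_swap (integrable_rpow_mul_airyIntegrand_ray hs hs1),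
    ← integral_rpow_neg_mul_exp_neg_cube hs1, Complex.ofReal_mul, ← integral_complex_ofReal,
    ← MeasureTheory.integral_const_mul, ← MeasureTheory.integral_const_mul]
  refine MeasureTheory.setIntegral_congr_fun measurableSet_Ioi fun r hr => ?_
  have hr0 : 0 < r := hr
  have h := integral_rpow_mul_cexp_neg_mul_Ioi (b := -Complex.I * airyRay * r) hs
    (by rw [re_neg_I_mul_airyRay_mul]; exact half_pos hr0)
  have e : ∀ x : ℝ, ((x ^ (s - 1) : ℝ) : ℂ) * airyIntegrand x (r * airyRay) =
      Complex.exp (-(r : ℂ) ^ 3 / 3) *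
        (((x ^ (s - 1) : ℝ) : ℂ) * Complex.exp (-(-Complex.I * airyRay * r) * x)) := by
    intro x
    rw [airyIntegrand_ray]
    ring
  simp only [e, MeasureTheory.integral_const_mul]
  rw [h, neg_I_mul_airyRay_mul_cpow hr0]
  push_cast
  ring

theorem integral_rpow_mul_airyAi {s : ℝ} (hs : 0 < s) (hs1 : s < 1) :
    ∫ x in Set.Ioi (0 : ℝ), x ^ (s - 1) * airyAi x =
      1 / Real.pi * (Real.cos (Real.pi / 6 + Real.pi * s / 3) *
        (Real.Gamma s * (3 ^ ((1 - s) / 3 - 1) * Real.Gamma ((1 - s) / 3)))) := by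
  have hI := (integrable_rpow_mul_airyIntegrand_ray hs hs1).integral_prod_left.const_mul airyRay
  have e : ∀ x : ℝ, x ^ (s - 1) * airyAi x = 1 / Real.pi * Complex.reCLM (airyRay *
      ∫ r in Set.Ioi (0 : ℝ), ((x ^ (s - 1) : ℝ) : ℂ) * airyIntegrand x (r * airyRay)) := by
    intro x
    rw [airyAi_eq_integral_ray, MeasureTheory.integral_const_mul, Complex.reCLM_apply,
      mul_left_comm airyRay, Complex.re_ofReal_mul]
    ring
  simp only [Function.uncurry_apply_pair] at hI
  rw [funext e, MeasureTheory.integral_const_mul, ContinuousLinearMap.integral_comp_comm _ hI,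
    MeasureTheory.integral_const_mul airyRay, integral_integral_airyIntegrand_ray hs hs1, airyRay_eq_exp, ← mul_assoc, ← Complex.exp_add,
    ← add_mul, ← Complex.ofReal_add, Complex.reCLM_apply, Complex.re_mul_ofReal,
    Complex.exp_ofReal_mul_I_re]

theorem integral_rpow_mul_airyAi_eq_Gamma {s : ℝ} (hs : 0 < s) (hs1 : s < 1) :
    ∫ x in Set.Ioi (0 : ℝ), x ^ (s - 1) * airyAi x =
      1 / (2 * Real.pi) * 3 ^ ((4 * s - 7) / 6) * Real.Gamma ((s + 1) / 3) *
        Real.Gamma (s / 3) := by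
  have hcos : Real.cos (Real.pi / 6 + Real.pi * s / 3) =
      Real.sin (Real.pi * ((1 - s) / 3)) := by
    rw [← Real.sin_pi_div_two_sub]
    ring_nf
  have hpi := Real.pi_pos
  have hsin : 0 < Real.sin (Real.pi * ((1 - s) / 3)) :=
    Real.sin_pos_of_pos_of_lt_pi (mul_pos hpi (by linarith)) (by nlinarith)
  have hG : 0 < Real.Gamma ((s + 2) / 3) := Real.Gamma_pos_of_pos (by linarith)
  have hrefl := Real.Gamma_mul_Gamma_one_sub ((1 - s) / 3)
  rw [show 1 - (1 - s) / 3 = (s + 2) / 3 by ring, eq_div_iff hsin.ne'] at hrefl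
  have htrip := Real.Gamma_triplication hs
  have hpow : (3 : ℝ) ^ s * 3 ^ ((1 - s) / 3 - 1) = 3 ^ ((4 * s - 7) / 6) * √3 := by
    rw [Real.sqrt_eq_rpow, ← Real.rpow_add (by norm_num), ← Real.rpow_add (by norm_num)]
    ring_nf
  have h3 : 0 < √3 := by positivity
  rw [integral_rpow_mul_airyAi hs hs1, hcos]
  -- This factor clears the denominators from reflection and triplication; with the special values
  -- made atoms, a polynomial identity remains.
  refine mul_right_cancel₀ (b := Real.Gamma ((s + 2) / 3) * (2 * √3 * Real.pi)) (by positivity) ?_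
  have h1 : 1 / Real.pi * Real.pi = 1 := by field_simp
  have h2 : 1 / (2 * Real.pi) * (2 * Real.pi) = 1 := by field_simp
  generalize (3 : ℝ) ^ ((1 - s) / 3 - 1) = P at *
  generalize (3 : ℝ) ^ ((4 * s - 7) / 6) = Q at *
  generalize 1 / Real.pi = u at *
  generalize 1 / (2 * Real.pi) = v at *
  generalize Real.sin (Real.pi * ((1 - s) / 3)) = σ at *
  generalize Real.Gamma ((1 - s) / 3) = g at *
  generalize Real.Gamma ((s + 2) / 3) = c at *
  generalize Real.Gamma ((s + 1) / 3) = b at *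
  generalize Real.Gamma (s / 3) = a at *
  generalize Real.Gamma s = γ at *
  linear_combination u * P * γ * (2 * √3 * Real.pi) * hrefl + P * γ * (2 * √3 * Real.pi) * h1
    - P * htrip + a * b * c * hpow - Q * √3 * a * b * c * h2

/-! ### Analytic continuation to Re s > 0 -/

theorem continuousOn_airyAi : ContinuousOn airyAi (Set.Ioi 0) := by
  have h : ContinuousOn (fun x : ℝ => ∫ r in Set.Ioi (0 : ℝ), airyIntegrand x (r * airyRay))
      (Set.Ioi 0) := by
    -- For x > 0 the factor exp(-rx/2) is at most 1, so the integrand at x = 0 dominates.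
    refine MeasureTheory.continuousOn_of_dominated (fun x _ => ?_) (fun x hx => ?_)
      (integrableOn_airyIntegrand_ray 0).norm (.of_forall fun r => ?_)
    · exact ((continuous_airyIntegrand x).comp (by fun_prop)).aestronglyMeasurable
    · filter_upwards [MeasureTheory.ae_restrict_mem measurableSet_Ioi] with r hr
      rw [norm_airyIntegrand_ray, norm_airyIntegrand_ray, mul_zero]
      gcongr
      have := mul_pos (Set.mem_Ioi.1 hr) (Set.mem_Ioi.1 hx)
      linarith
    · unfold airyIntegrand
      fun_prop
  rw [funext airyAi_eq_integral_ray]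
  exact continuousOn_const.mul (Complex.continuous_re.comp_continuousOn (continuousOn_const.mul h))

theorem locallyIntegrableOn_airyAi :
    MeasureTheory.LocallyIntegrableOn (fun x : ℝ => (airyAi x : ℂ)) (Set.Ioi 0) :=
  (Complex.continuous_ofReal.comp_continuousOn continuousOn_airyAi).locallyIntegrableOn
    measurableSet_Ioi

theorem airyAi_isBigO_exp_neg :
    (fun x : ℝ => (airyAi x : ℂ)) =O[atTop] fun x => Real.exp (-1 * x) := by
  obtain ⟨K, hK⟩ := exists_abs_airyAi_le
  refine .of_bound K (.of_forall fun x => ?_)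
  rw [Complex.norm_real, Real.norm_eq_abs, Real.norm_of_nonneg (Real.exp_pos _).le, neg_one_mul]
  exact hK x

theorem airyAi_isBigO_zero :
    (fun x : ℝ => (airyAi x : ℂ)) =O[𝓝[>] 0] fun x => x ^ (-(0 : ℝ)) := by
  obtain ⟨K, hK⟩ := exists_abs_airyAi_le
  have hK0 : 0 ≤ K := by simpa using (abs_nonneg _).trans (hK 0)
  refine .of_bound K ?_
  filter_upwards [self_mem_nhdsWithin] with x hx
  rw [Complex.norm_real, neg_zero, Real.rpow_zero, norm_one]
  exact (hK x).trans (mul_le_mul_of_nonneg_left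
    (Real.exp_le_one_iff.2 (neg_nonpos.2 (le_of_lt hx))) hK0)

theorem mellin_airyAi_ofReal {s : ℝ} (hs : 0 < s) (hs1 : s < 1) :
    mellin (fun x : ℝ => (airyAi x : ℂ)) s =
      1 / (2 * (Real.pi : ℂ)) * (3 : ℂ) ^ ((4 * (s : ℂ) - 7) / 6) *
        Complex.Gamma ((s + 1) / 3) * Complex.Gamma (s / 3) := by
  have h := congrArg (fun y : ℝ => (y : ℂ)) (integral_rpow_mul_airyAi_eq_Gamma hs hs1)
  simp only [← integral_complex_ofReal] at h
  push_cast [Complex.ofReal_cpow (show (0 : ℝ) ≤ 3 by norm_num), ← Complex.Gamma_ofReal] at h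
  rw [← h, mellin]
  refine MeasureTheory.setIntegral_congr_fun measurableSet_Ioi fun x hx => ?_
  simp only [smul_eq_mul]
  rw [Complex.ofReal_cpow (le_of_lt hx)]
  push_cast
  rfl

theorem differentiableAt_Gamma_of_re_pos {s : ℂ} (hs : 0 < s.re) :
    DifferentiableAt ℂ Complex.Gamma s := by
  refine Complex.differentiableAt_Gamma s fun m h => ?_
  rw [h] at hs
  simp only [Complex.neg_re, Complex.natCast_re] at hs
  linarith [(Nat.cast_nonneg m : (0 : ℝ) ≤ m)]

theorem mellin_airyAi {s : ℂ} (hs : 0 < s.re) :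
    mellin (fun x : ℝ => (airyAi x : ℂ)) s =
      1 / (2 * (Real.pi : ℂ)) * (3 : ℂ) ^ ((4 * s - 7) / 6) *
        Complex.Gamma ((s + 1) / 3) * Complex.Gamma (s / 3) := by
  have hopen : IsOpen {z : ℂ | 0 < z.re} := isOpen_lt continuous_const Complex.continuous_re
  have hf : AnalyticOnNhd ℂ (mellin fun x : ℝ => (airyAi x : ℂ)) {z | 0 < z.re} :=
    DifferentiableOn.analyticOnNhd (fun z hz => (mellin_differentiableAt_of_isBigO_rpow_exp one_pos
      locallyIntegrableOn_airyAi airyAi_isBigO_exp_neg airyAi_isBigO_zero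
      hz).differentiableWithinAt) hopen
  have hg : AnalyticOnNhd ℂ (fun s : ℂ => 1 / (2 * (Real.pi : ℂ)) * (3 : ℂ) ^ ((4 * s - 7) / 6) *
      Complex.Gamma ((s + 1) / 3) * Complex.Gamma (s / 3)) {z | 0 < z.re} := by
    refine DifferentiableOn.analyticOnNhd (fun z hz => ?_) hopen
    have hz' : 0 < z.re := hz
    have h1 : 0 < ((z + 1) / 3).re := by
      rw [Complex.div_ofNat_re]
      simp
      positivity
    have h2 : 0 < (z / 3).re := by
      rw [Complex.div_ofNat_re]
      positivity
    have d0 : DifferentiableAt ℂ (fun s : ℂ => (3 : ℂ) ^ ((4 * s - 7) / 6)) z :=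
      DifferentiableAt.const_cpow (by fun_prop) (.inl (by norm_num))
    have d1 : DifferentiableAt ℂ (fun s : ℂ => Complex.Gamma ((s + 1) / 3)) z :=
      (differentiableAt_Gamma_of_re_pos h1).comp z (f := fun s : ℂ => (s + 1) / 3) (by fun_prop)
    have d2 : DifferentiableAt ℂ (fun s : ℂ => Complex.Gamma (s / 3)) z :=
      (differentiableAt_Gamma_of_re_pos h2).comp z (f := fun s : ℂ => s / 3) (by fun_prop)
    exact (((d0.const_mul _).mul d1).mul d2).differentiableWithinAt
  -- The point 1/2 is interior to (0, 1), where the real formula holds.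
  refine hf.eqOn_of_preconnected_of_frequently_eq hg
    (convex_halfSpace_re_gt 0).isPreconnected (z₀ := ((1 / 2 : ℝ) : ℂ))
    (by simp only [Set.mem_ofPred_eq, Complex.ofReal_re]; norm_num) ?_ hs
  have htend : Tendsto (fun r : ℝ => (r : ℂ)) (𝓝[≠] (1 / 2 : ℝ)) (𝓝[≠] ((1 / 2 : ℝ) : ℂ)) :=
    Complex.continuous_ofReal.continuousWithinAt.tendsto_nhdsWithin fun r hr =>
      Complex.ofReal_injective.ne hr
  refine htend.frequently (Eventually.frequently ?_)
  filter_upwards [nhdsWithin_le_nhds (Ioo_mem_nhds (by norm_num : (0 : ℝ) < 1 / 2)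
    (by norm_num : (1 / 2 : ℝ) < 1))] with r hr
  exact mellin_airyAi_ofReal hr.1 hr.2

theorem mainTheorem8 :
    (∀ x : ℝ, Tendsto (airyPartial x) atTop (𝓝 (airyAi x))) ∧
    ∀ s : ℂ, 0 < s.re →
      HasMellin (fun x : ℝ => (airyAi x : ℂ)) s
        (1 / (2 * (Real.pi : ℂ)) * (3 : ℂ) ^ ((4 * s - 7) / 6) *
          Complex.Gamma ((s + 1) / 3) * Complex.Gamma (s / 3)) := by
  refine ⟨fun x => ?_, fun s hs => ⟨?_, mellin_airyAi hs⟩⟩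
  · rw [airyAi_eq_integral_ray]
    exact tendsto_airyPartial x
  · exact mellinConvergent_of_isBigO_rpow_exp one_pos locallyIntegrableOn_airyAi
      airyAi_isBigO_exp_neg airyAi_isBigO_zero hs
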